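/- Let $q$ be an odd prime power and let $\mathbb F_q$ be the field with $q$ elements. Let $s(4,q)$ be the number of elements of $SL_2(\mathbb F_q)$ of the form $x^4$ with $x\in SL_2(\mathbb F_q)$, and let $c(4,q)$ be the number of conjugacy classes of $SL_2(\mathbb F_q)$ consisting of such elements. Then $$ s(4,q) = \begin{cases} \frac{3}{8}q^3 - \frac{1}{2}q^2 - \frac{7}{8}q + 1, & q\equiv 1 \pmod 8,\\ \frac{3}{8}(q^3-q), & q\equiv 3 \text{ or } 5 \pmod 8,\\ \frac{3}{8}q^3 - \frac{1}{2}q^2 + \frac{1}{8}q + 1, & q\equiv 7 \pmod 8, \end{cases} $$ and $$ c(4,q) = \begin{cases} \frac{3q+21}{8}, & q\equiv 1 \pmod 8,\\ \frac{3q+15}{8}, & q\equiv 3 \pmod 8,\\ \frac{3q+17}{8}, & q\equiv 5 \pmod 8,\\ \frac{3q+19}{8}, & q\equiv 7 \pmod 8. \end{cases} $$ Consequently, as $q\to\infty$ through the odd prime powers, both the proportion $s(4,q)/|SL_2(\mathbb F_q)|$ of fourth powers and the proportion of the conjugacy classes of $SL_2(\mathbb F_q)$ that consist of fourth powers, i.e.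 $c(4,q)$ divided by the total number of conjugacy classes of $SL_2(\mathbb F_q)$, tend to $\frac{3}{8}$. -/

import Mathlib

/-- The set `G ^ n = {x ^ n | x ∈ G}` of `n`-th powers in a group `G`. -/
def nthPowers (G : Type*) [Group G] (n : ℕ) : Set G := {g | ∃ x : G, x ^ n = g}

/-- The set of conjugacy classes of `G` that are `n`-th powers, that is, the classes of the
`n`-th powers in `G` (being an `n`-th power is invariant under conjugation). -/
def nthPowerClasses (G : Type*) [Group G] (n : ℕ) : Set (ConjClasses G) :=
  {C | ∃ g ∈ nthPowers G n, ConjClasses.mk g = C}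

/-- The group `SL₂(F)`. -/
abbrev SL2 (F : Type*) [Field F] : Type _ := Matrix.SpecialLinearGroup (Fin 2) F

/-- `s(n, q)`: the number of `n`-th powers in `SL₂(F)`, where `F` is a field with `q` elements. -/
noncomputable def powerCount (n : ℕ) (F : Type*) [Field F] : ℕ :=
  (nthPowers (SL2 F) n).ncard

/-- `c(n, q)`: the number of conjugacy classes of `SL₂(F)` that are `n`-th powers, where `F` is
a field with `q` elements. -/
noncomputable def powerClassCount (n : ℕ) (F : Type*) [Field F] : ℕ :=
  (nthPowerClasses (SL2 F) n).ncard

/-! Whether `g` is a fourth power depends almost only on its trace. By Cayley–Hamilton, x⁴ = (s³ −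
2s)x − (s² − 1) with s = tr x, so tr x⁴ = Q(s) = s⁴ − 4s² + 2. When s³ − 2s ≠ 0 this equation can be
solved for x, so for t² ≠ 4 a matrix of trace t is a fourth power exactly when t = Q(s) for some s.
Every matrix of trace 2 is a fourth power; of trace −2, only −1 can be, and it is exactly when 2 is
a square.

Write χ for the quadratic character. Trace t is taken by q² + qχ(t² − 4) matrices
(`ncard_trace_eq`), which form one class if t² ≠ 4 and three otherwise. It remains to count the
values t = Q(s) with χ(t² − 4) = e for e = ±1 (`card_quarticTraces`). Over such a t the fibre of Q
has 3 + χ(−1)e elements, and t² − 4 = (s³ − 2s)²(s² − 4) reduces the count of s to that of χ(s² − 4)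
= e. Fibres have size 4 for one sign and 2 for the other, each sign taking about half of the s:
hence the density 1/2 · 1/4 + 1/2 · 1/2 = 3/8. -/

section

open Finset

/-- The trace of an element of `SL₂(F)`. -/
def slTrace {F : Type*} [Field F] (g : SL2 F) : F := g.1 0 0 + g.1 1 1

theorem four_ne_zero_of_two {K : Type*} [Field K] (h2 : (2 : K) ≠ 0) : (4 : K) ≠ 0 := by
  rw [show (4 : K) = 2 * 2 by norm_num]; exact mul_ne_zero h2 h2

theorem ncard_eq_sum_fiber {α β : Type*} [Finite α] [Fintype β] (S : Set α) (f : α → β) :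
    S.ncard = ∑ t : β, {x | x ∈ S ∧ f x = t}.ncard := by
  classical
  have := Fintype.ofFinite α
  rw [Set.ncard_eq_toFinset_card' S,
    Finset.card_eq_sum_card_fiberwise (f := f) (t := univ) (fun _ _ => Finset.mem_coe.2 (mem_univ _))]
  refine Finset.sum_congr rfl fun t _ => ?_
  rw [Set.ncard_eq_toFinset_card']
  congr 1
  ext; simp

/-! ### Matrices of given trace and the order of SL₂ -/

section Counting

variable {F : Type*} [Field F] [Fintype F] [DecidableEq F]

theorem card_pairs_mul_eq (n : F) :
    ((univ.filter fun p : F × F => p.1 * p.2 = n).card : ℤ) =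
      Fintype.card F - 1 + if n = 0 then (Fintype.card F : ℤ) else 0 := by
  have h : ∀ b : F, (∑ c : F, if b * c = n then (1 : ℤ) else 0) =
      if b = 0 then (if n = 0 then (Fintype.card F : ℤ) else 0) else 1 := by
    intro b
    split_ifs with hb hn
    · simp [hb, hn]
    · simp [hb, Ne.symm hn]
    · have : ∀ c : F, (b * c = n) ↔ (c = b⁻¹ * n) := fun c => by
        constructor
        · rintro rfl; field_simp
        · rintro rfl; field_simp
      simp [this]
  rw [Finset.card_filter, Nat.cast_sum, Fintype.sum_prod_type]
  push_cast
  simp_rw [h]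
  rw [Finset.sum_ite, Finset.filter_eq' univ (0 : F), Finset.filter_ne' univ (0 : F)]
  have : 1 ≤ Fintype.card F := Fintype.card_pos
  simp [Finset.card_erase_of_mem, Nat.cast_sub this, Finset.card_univ]
  ring

theorem card_sqrt (hF : ringChar F ≠ 2) (a : F) :
    ((univ.filter fun x : F => x ^ 2 = a).card : ℤ) = quadraticChar F a + 1 := by
  rw [← quadraticChar_card_sqrts hF a]
  congr 2
  ext; simp

theorem card_roots_trace (hF : ringChar F ≠ 2) (t : F) :
    ((univ.filter fun a : F => a * (t - a) - 1 = 0).card : ℤ) =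
      quadraticChar F (t ^ 2 - 4) + 1 := by
  have h2 : (2 : F) ≠ 0 := Ring.two_ne_zero hF
  rw [← card_sqrt hF]
  congr 1
  apply Finset.card_bij' (fun a _ => 2 * a - t) (fun x _ => (x + t) / 2)
  · intro a ha
    simp only [mem_filter, mem_univ, true_and] at ha ⊢
    linear_combination -4 * ha
  · intro x hx
    simp only [mem_filter, mem_univ, true_and] at hx ⊢
    field_simp
    linear_combination -hx
  · intro a _; field_simp; ring
  · intro x _; field_simp; ring

/-- With a the upper left entry, the off-diagonal entries satisfy bc = a(t − a) − 1. This has q − 1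
solutions (b, c), and q more when the right side vanishes, which happens for 1 + χ(t² − 4) values of
a. -/
theorem ncard_trace_eq (hF : ringChar F ≠ 2) (t : F) :
    ({g : SL2 F | slTrace g = t}.ncard : ℤ) =
      (Fintype.card F : ℤ) ^ 2 + Fintype.card F * quadraticChar F (t ^ 2 - 4) := by
  have key : {g : SL2 F | slTrace g = t}.ncard =
      (univ.filter fun p : F × F × F => p.2.1 * p.2.2 = p.1 * (t - p.1) - 1).card := by
    rw [← Set.ncard_coe_finset]
    refine Set.ncard_congr (fun g _ => (g.1 0 0, g.1 0 1, g.1 1 0)) ?_ ?_ ?_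
    · intro g hg
      have hd := Matrix.det_fin_two g.1
      rw [g.2] at hd
      simp only [Set.mem_ofPred_eq, slTrace] at hg
      simp only [coe_filter, mem_univ, true_and, Set.mem_ofPred_eq, ← hg]
      linear_combination hd
    · intro g h hg hh e
      simp only [Set.mem_ofPred_eq, slTrace] at hg hh
      simp only [Prod.mk.injEq] at e
      obtain ⟨e1, e2, e3⟩ := e
      ext i j
      fin_cases i <;> fin_cases j <;> simp [e1, e2, e3]
      linear_combination hg - hh - e1
    · rintro ⟨a, b, c⟩ h
      simp only [coe_filter, mem_univ, true_and, Set.mem_ofPred_eq] at h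
      refine ⟨⟨!![a, b; c, t - a], ?_⟩, ?_, ?_⟩
      · rw [Matrix.det_fin_two_of]; linear_combination -h
      · change a + (t - a) = t
        ring
      · simp
  rw [key, Finset.card_filter, Nat.cast_sum, Fintype.sum_prod_type]
  have : ∀ a : F, (∑ y : F × F, ((if y.1 * y.2 = a * (t - a) - 1 then 1 else 0 : ℕ) : ℤ)) =
      Fintype.card F - 1 + if a * (t - a) - 1 = 0 then (Fintype.card F : ℤ) else 0 := by
    intro a
    rw [← card_pairs_mul_eq, Finset.card_filter, Nat.cast_sum]
  simp only [this]
  rw [Finset.sum_add_distrib, ← Finset.sum_filter, Finset.sum_const, Finset.sum_const,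
    nsmul_eq_mul, nsmul_eq_mul, card_roots_trace hF, Finset.card_univ]
  ring

/-- The hyperbola s² − y² = 4 becomes uv = 4 in the coordinates s − y, s + y, so it has q − 1
points; counting them over each s gives q plus the sum. -/
theorem sum_quadraticChar_sq_sub_four (hF : ringChar F ≠ 2) :
    ∑ s : F, quadraticChar F (s ^ 2 - 4) = -1 := by
  have h2 : (2 : F) ≠ 0 := Ring.two_ne_zero hF
  have h4 : (4 : F) ≠ 0 := four_ne_zero_of_two h2
  have e : (univ.filter fun p : F × F => p.2 ^ 2 = p.1 ^ 2 - 4).card =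
      (univ.filter fun p : F × F => p.1 * p.2 = 4).card := by
    apply Finset.card_bij' (fun p _ => (p.1 - p.2, p.1 + p.2))
      (fun p _ => ((p.1 + p.2) / 2, (p.2 - p.1) / 2))
    · rintro ⟨x, y⟩ _; ext <;> simp <;> field_simp <;> ring
    · rintro ⟨x, y⟩ _; ext <;> simp <;> field_simp <;> ring
    · rintro ⟨x, y⟩ hp
      simp only [mem_filter, mem_univ, true_and] at hp ⊢
      linear_combination -hp
    · rintro ⟨x, y⟩ hp
      simp only [mem_filter, mem_univ, true_and] at hp ⊢
      field_simp
      linear_combination -4 * hp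
  have h := card_pairs_mul_eq (4 : F)
  rw [← e, Finset.card_filter, Nat.cast_sum, Fintype.sum_prod_type, if_neg h4] at h
  have : ∀ s : F, (∑ y : F, ((if y ^ 2 = s ^ 2 - 4 then 1 else 0 : ℕ) : ℤ)) =
      quadraticChar F (s ^ 2 - 4) + 1 := by
    intro s
    rw [← card_sqrt hF, Finset.card_filter, Nat.cast_sum]
  simp only [this] at h
  rw [Finset.sum_add_distrib, Finset.sum_const, Finset.card_univ, nsmul_eq_mul] at h
  linarith

theorem natCard_SL2 (hF : ringChar F ≠ 2) :
    (Nat.card (SL2 F) : ℤ) = (Fintype.card F : ℤ) ^ 3 - Fintype.card F := by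
  rw [← Set.ncard_univ, ncard_eq_sum_fiber _ slTrace, Nat.cast_sum]
  simp only [Set.mem_univ, true_and, ncard_trace_eq hF]
  rw [Finset.sum_add_distrib, ← Finset.mul_sum, sum_quadraticChar_sq_sub_four hF, Finset.sum_const,
    Finset.card_univ, nsmul_eq_mul]
  ring

end Counting

/-! ### Fourth powers recognised by their trace -/

section FourthPowers

variable {F : Type*} [Field F]

theorem sl2_det (x : SL2 F) : x.1 0 0 * x.1 1 1 - x.1 0 1 * x.1 1 0 = 1 := by
  rw [← Matrix.det_fin_two, x.2]

theorem SL2.ext_entries {g h : SL2 F} (h00 : g.1 0 0 = h.1 0 0) (h01 : g.1 0 1 = h.1 0 1)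
    (h10 : g.1 1 0 = h.1 1 0) (h11 : g.1 1 1 = h.1 1 1) : g = h := by
  apply Subtype.ext
  ext i j
  fin_cases i <;> fin_cases j <;> assumption

theorem sl2_mul_entry (x y : SL2 F) (i j : Fin 2) :
    (x * y).1 i j = x.1 i 0 * y.1 0 j + x.1 i 1 * y.1 1 j := by
  rw [Matrix.SpecialLinearGroup.coe_mul, Matrix.mul_apply, Fin.sum_univ_two]

/-- The element of `SL₂(F)` with given entries. -/
def slOf (a b c d : F) (h : a * d - b * c = 1) : SL2 F :=
  ⟨!![a, b; c, d], by rw [Matrix.det_fin_two_of, h]⟩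

section Entries

variable (a b c d : F) (h : a * d - b * c = 1)

@[simp] theorem slOf_zero_zero : (slOf a b c d h).1 0 0 = a := rfl

@[simp] theorem slOf_zero_one : (slOf a b c d h).1 0 1 = b := rfl

@[simp] theorem slOf_one_zero : (slOf a b c d h).1 1 0 = c := rfl

@[simp] theorem slOf_one_one : (slOf a b c d h).1 1 1 = d := rfl

end Entries

/-- The trace of `x ^ 4` as a polynomial in the trace of `x`, for `x` of determinant `1`. -/
def quarticTrace (s : F) : F := s ^ 4 - 4 * s ^ 2 + 2

theorem sl2_pow_four (x : SL2 F) :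
    (x ^ 4).1 = (slTrace x ^ 3 - 2 * slTrace x) • x.1 - (slTrace x ^ 2 - 1) • (1 : Matrix _ _ F) := by
  have h2 : x.1 * x.1 = slTrace x • x.1 - 1 := by
    have hd := sl2_det x
    ext i j
    fin_cases i <;> fin_cases j <;>
      simp [Matrix.mul_apply, Fin.sum_univ_two, slTrace]
    · linear_combination -hd
    · ring
    · ring
    · linear_combination -hd
  have e : (x ^ 4).1 = (x.1 * x.1) * (x.1 * x.1) := by
    rw [show (x ^ 4).1 = x.1 ^ 4 from Matrix.SpecialLinearGroup.coe_pow x 4]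
    noncomm_ring
  rw [e, h2]
  have : (slTrace x • x.1 - 1) * (slTrace x • x.1 - 1) =
      slTrace x ^ 2 • (x.1 * x.1) - (2 * slTrace x) • x.1 + 1 := by
    rw [sub_mul, mul_sub, smul_mul_smul_comm, two_mul, add_smul, sq]
    simp only [one_mul, mul_one]
    abel
  rw [this, h2]
  module

theorem slTrace_pow_four (x : SL2 F) : slTrace (x ^ 4) = quarticTrace (slTrace x) := by
  have h := sl2_pow_four x
  unfold slTrace at h ⊢
  rw [h]
  simp [quarticTrace]
  ring

theorem quarticTrace_sq_sub_four (s : F) :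
    quarticTrace s ^ 2 - 4 = (s ^ 3 - 2 * s) ^ 2 * (s ^ 2 - 4) := by
  unfold quarticTrace; ring

/-- Solving `sl2_pow_four` for x gives x = (g + (s² − 1))/k with k = s³ − 2s; the trace condition
makes this x have determinant 1 and trace s. -/
theorem mem_nthPowers_four_of_trace {g : SL2 F} {s : F} (h : slTrace g = quarticTrace s)
    (hs : s ^ 3 - 2 * s ≠ 0) : g ∈ nthPowers (SL2 F) 4 := by
  have hd := sl2_det g
  have ht : g.1 1 1 = quarticTrace s - g.1 0 0 := by rw [← h, slTrace]; ring
  rw [ht] at hd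
  unfold quarticTrace at ht hd
  set k := s ^ 3 - 2 * s with hk
  let m : Matrix (Fin 2) (Fin 2) F :=
    !![(g.1 0 0 + (s ^ 2 - 1)) / k, g.1 0 1 / k; g.1 1 0 / k, (g.1 1 1 + (s ^ 2 - 1)) / k]
  have hm : m.det = 1 := by
    rw [Matrix.det_fin_two_of, ht]
    field_simp
    rw [hk]
    linear_combination hd
  let x : SL2 F := ⟨m, hm⟩
  have hx : slTrace x = s := by
    simp only [slTrace, x, m, Matrix.of_apply, Matrix.cons_val', Matrix.cons_val_zero,
      Matrix.cons_val_one, Matrix.cons_val_fin_one, ht]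
    field_simp
    rw [hk]; ring
  refine ⟨x, ?_⟩
  apply Subtype.ext
  rw [sl2_pow_four, hx, ← hk]
  ext i j
  fin_cases i <;> fin_cases j <;> simp [x, m] <;> field_simp <;> ring

theorem mem_nthPowers_four_of_trace_two (h2 : (2 : F) ≠ 0) {g : SL2 F} (h : slTrace g = 2) :
    g ∈ nthPowers (SL2 F) 4 := by
  have hd := sl2_det g
  have h4 : (4 : F) ≠ 0 := four_ne_zero_of_two h2
  have ht : g.1 1 1 = 2 - g.1 0 0 := by rw [← h, slTrace]; ring
  rw [ht] at hd
  -- The same root taken at s = 2, where s² − 1 = 3 and s³ − 2s = 4.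
  let m : Matrix (Fin 2) (Fin 2) F :=
    !![(g.1 0 0 + 3) / 4, g.1 0 1 / 4; g.1 1 0 / 4, (g.1 1 1 + 3) / 4]
  have hm : m.det = 1 := by
    rw [Matrix.det_fin_two_of, ht]
    field_simp
    linear_combination hd
  let x : SL2 F := ⟨m, hm⟩
  have hx : slTrace x = 2 := by
    simp only [slTrace, x, m, Matrix.of_apply, Matrix.cons_val', Matrix.cons_val_zero,
      Matrix.cons_val_one, Matrix.cons_val_fin_one, ht]
    field_simp
    ring
  refine ⟨x, ?_⟩
  apply Subtype.ext
  rw [sl2_pow_four, hx]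
  ext i j
  fin_cases i <;> fin_cases j <;> simp [x, m] <;> field_simp <;> ring

theorem pow_four_eq_neg_one_of_trace {x : SL2 F} (h : slTrace x ^ 2 = 2) : x ^ 4 = -1 := by
  apply Subtype.ext
  rw [sl2_pow_four, show slTrace x ^ 3 - 2 * slTrace x = 0 by linear_combination slTrace x * h, h]
  rw [Matrix.SpecialLinearGroup.coe_neg, Matrix.SpecialLinearGroup.coe_one]
  norm_num

theorem quarticTrace_eq_neg_two {s : F} (h : quarticTrace s = -2) : s ^ 2 = 2 := by
  have : (s ^ 2 - 2) ^ 2 = 0 := by unfold quarticTrace at h; linear_combination h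
  exact sub_eq_zero.1 (pow_eq_zero_iff two_ne_zero |>.1 this)

theorem eq_neg_one_of_mem_nthPowers_four {g : SL2 F} (hg : g ∈ nthPowers (SL2 F) 4)
    (h : slTrace g = -2) : g = -1 ∧ IsSquare (2 : F) := by
  obtain ⟨x, rfl⟩ := hg
  rw [slTrace_pow_four] at h
  have hs := quarticTrace_eq_neg_two h
  exact ⟨pow_four_eq_neg_one_of_trace hs, ⟨slTrace x, by rw [← hs, sq]⟩⟩

theorem neg_one_mem_nthPowers_four (h : IsSquare (2 : F)) : (-1 : SL2 F) ∈ nthPowers (SL2 F) 4 := by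
  obtain ⟨r, hr⟩ := h
  -- When the trace squares to 2 the coefficient of x in x⁴ vanishes, so any matrix of determinant 1
  -- and trace r serves.
  refine ⟨⟨!![0, -1; 1, r], by simp [Matrix.det_fin_two_of]⟩, ?_⟩
  apply pow_four_eq_neg_one_of_trace
  simp [slTrace, sq, ← hr]

theorem slTrace_neg_one : slTrace (-1 : SL2 F) = -2 := by
  simp [slTrace]; norm_num

theorem mem_nthPowers_four_iff_of_trace_ne {g : SL2 F} (h : slTrace g ^ 2 - 4 ≠ 0) :
    g ∈ nthPowers (SL2 F) 4 ↔ ∃ s, quarticTrace s = slTrace g := by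
  constructor
  · rintro ⟨x, rfl⟩
    exact ⟨_, (slTrace_pow_four x).symm⟩
  · rintro ⟨s, hs⟩
    refine mem_nthPowers_four_of_trace hs.symm fun h0 => h ?_
    rw [← hs, quarticTrace_sq_sub_four, h0]; ring

end FourthPowers

/-! ### Conjugacy classes of given trace -/

section Conjugacy

variable {F : Type*} [Field F]

theorem slTrace_conj (g x : SL2 F) : slTrace (x * g * x⁻¹) = slTrace g := by
  have h : ∀ y : SL2 F, slTrace y = Matrix.trace y.1 := fun y => (Matrix.trace_fin_two _).symm
  rw [h, h, Matrix.SpecialLinearGroup.coe_mul, Matrix.trace_mul_comm,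
    ← Matrix.SpecialLinearGroup.coe_mul, ← mul_assoc, inv_mul_cancel, one_mul]

theorem slTrace_eq_of_isConj {g h : SL2 F} (H : IsConj g h) : slTrace g = slTrace h := by
  obtain ⟨x, rfl⟩ := isConj_iff.1 H
  exact (slTrace_conj g x).symm

theorem nthPowers_conj {G : Type*} [Group G] {n : ℕ} {g h : G} (H : IsConj g h)
    (hg : g ∈ nthPowers G n) : h ∈ nthPowers G n := by
  obtain ⟨y, rfl⟩ := hg
  obtain ⟨x, rfl⟩ := isConj_iff.1 H
  exact ⟨x * y * x⁻¹, conj_pow⟩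

theorem mk_mem_nthPowerClasses {G : Type*} [Group G] {n : ℕ} {g : G} :
    ConjClasses.mk g ∈ nthPowerClasses G n ↔ g ∈ nthPowers G n := by
  constructor
  · rintro ⟨h, hh, e⟩
    exact nthPowers_conj (ConjClasses.mk_eq_mk_iff_isConj.1 e) hh
  · exact fun h => ⟨g, h, rfl⟩

/-- The common trace of the elements of a conjugacy class. -/
def classTrace : ConjClasses (SL2 F) → F :=
  Quotient.lift slTrace fun _ _ h => slTrace_eq_of_isConj h

@[simp] theorem classTrace_mk (g : SL2 F) : classTrace (ConjClasses.mk g) = slTrace g := rfl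

/-- The matrix of determinant `1` and trace `t` sending the first basis vector to `d` times the
second. -/
def companionSL (d t : F) (hd : d ≠ 0) : SL2 F :=
  slOf 0 (-d⁻¹) d t (by simp [hd])

@[simp] theorem slTrace_companionSL (d t : F) (hd : d ≠ 0) : slTrace (companionSL d t hd) = t := by
  simp [slTrace, companionSL]

/-- The determinant of the pair `v, g v` for `v = (x, y)`. -/
def cyclicForm (g : SL2 F) (x y : F) : F :=
  g.1 1 0 * x ^ 2 + (g.1 1 1 - g.1 0 0) * x * y - g.1 0 1 * y ^ 2

/-- For v = (x, y), the basis v, gv/d has determinant 1, and in it g takes companion form. -/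
theorem isConj_companionSL {g : SL2 F} {d x y : F} (hd : d ≠ 0) (h : cyclicForm g x y = d) :
    IsConj (companionSL d (slTrace g) hd) g := by
  have hg := sl2_det g
  unfold cyclicForm at h
  rw [isConj_iff]
  refine ⟨slOf x ((g.1 0 0 * x + g.1 0 1 * y) / d) y ((g.1 1 0 * x + g.1 1 1 * y) / d) ?_, ?_⟩
  · field_simp
    linear_combination h
  · rw [mul_inv_eq_iff_eq_mul]
    apply SL2.ext_entries <;>
      simp [companionSL, sl2_mul_entry, slTrace] <;> field_simp
    · linear_combination x * hg
    · linear_combination y * hg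

theorem exists_cyclicForm_ne_zero {g : SL2 F} (h : ¬ (g.1 1 0 = 0 ∧ g.1 0 1 = 0 ∧ g.1 0 0 = g.1 1 1)) :
    ∃ x y, cyclicForm g x y ≠ 0 := by
  by_contra! H
  apply h
  have h1 := H 1 0
  have h2 := H 0 1
  have h3 := H 1 1
  simp only [cyclicForm] at h1 h2 h3
  have e1 : g.1 1 0 = 0 := by linear_combination h1
  have e2 : g.1 0 1 = 0 := by linear_combination -h2
  refine ⟨e1, e2, ?_⟩
  linear_combination -h3 + e1 - e2

/-- An intertwiner is determined by its first row, and t² = 4 makes its determinant n times a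
square; determinant 1 would then make n a square. -/
theorem not_isConj_companionSL (h2 : (2 : F) ≠ 0) {t n : F} (ht : t ^ 2 = 4) (hn : n ≠ 0)
    (hsq : ¬ IsSquare n) : ¬ IsConj (companionSL 1 t one_ne_zero) (companionSL n t hn) := by
  intro H
  obtain ⟨x, hx⟩ := isConj_iff.1 H
  rw [mul_inv_eq_iff_eq_mul] at hx
  have hd := sl2_det x
  have e00 := congrArg (fun g : SL2 F => g.1 0 0) hx
  have e10 := congrArg (fun g : SL2 F => g.1 1 0) hx
  simp [companionSL, sl2_mul_entry] at e00 e10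
  have e10' : x.1 1 0 = -n * x.1 0 1 := by rw [e00]; field_simp
  rw [e10, e10'] at hd
  have key : n * (x.1 0 0 - t / 2 * x.1 0 1) ^ 2 = 1 := by
    field_simp
    linear_combination 4 * hd + n * x.1 0 1 ^ 2 * ht
  apply hsq
  refine ⟨(x.1 0 0 - t / 2 * x.1 0 1)⁻¹, ?_⟩
  have : x.1 0 0 - t / 2 * x.1 0 1 ≠ 0 := by
    intro h0; rw [h0] at key; simp at key
  generalize x.1 0 0 - t / 2 * x.1 0 1 = w at key this
  field_simp
  linear_combination key

theorem cyclicForm_smul (g : SL2 F) (k x y : F) :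
    cyclicForm g (k * x) (k * y) = k ^ 2 * cyclicForm g x y := by
  unfold cyclicForm; ring

variable [Finite F]

theorem exists_sq_sub_mul_sq (h2 : ringChar F ≠ 2) {D : F} (hD : D ≠ 0) (n : F) :
    ∃ x y : F, x ^ 2 - D * y ^ 2 = n := by
  classical
  have := Fintype.ofFinite F
  open Polynomial in
  obtain ⟨a, b, hab⟩ := FiniteField.exists_root_sum_quadratic (R := F)
    (f := (X ^ 2 - C n : F[X])) (g := (C (-D) * X ^ 2 : F[X]))
    (degree_X_pow_sub_C (by norm_num) _)
    (by simpa using degree_C_mul_X_pow 2 (neg_ne_zero.2 hD))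
    (FiniteField.odd_card_of_char_ne_two h2)
  exact ⟨a, b, by simp at hab; linear_combination hab⟩

/-- The form has discriminant t² − 4, hence is nondegenerate, and such a binary form over a finite
field represents 1. The witnesses come from completing the square in a variable with nonzero square
coefficient; if both vanish the form is a multiple of xy. -/
theorem exists_cyclicForm_eq_one (hF : ringChar F ≠ 2) {g : SL2 F} (h : slTrace g ^ 2 - 4 ≠ 0) :
    ∃ x y, cyclicForm g x y = 1 := by
  have h2 : (2 : F) ≠ 0 := Ring.two_ne_zero hF
  have hd := sl2_det g
  have hD : slTrace g ^ 2 - 4 = (g.1 1 1 - g.1 0 0) ^ 2 + 4 * g.1 0 1 * g.1 1 0 := by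
    unfold slTrace; linear_combination 4 * hd
  unfold cyclicForm
  by_cases hc : g.1 1 0 = 0
  · by_cases hb : g.1 0 1 = 0
    · have : g.1 1 1 - g.1 0 0 ≠ 0 := by
        intro h0; apply h; rw [hD, h0, hb]; ring
      exact ⟨1, (g.1 1 1 - g.1 0 0)⁻¹, by rw [hc, hb]; field_simp; ring⟩
    · obtain ⟨X, Y, hXY⟩ := exists_sq_sub_mul_sq hF h (-4 * g.1 0 1)
      refine ⟨Y, (X + (g.1 1 1 - g.1 0 0) * Y) / (2 * g.1 0 1), ?_⟩
      rw [hD] at hXY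
      field_simp
      linear_combination -hXY
  · obtain ⟨X, Y, hXY⟩ := exists_sq_sub_mul_sq hF h (4 * g.1 1 0)
    refine ⟨(X - (g.1 1 1 - g.1 0 0) * Y) / (2 * g.1 1 0), Y, ?_⟩
    rw [hD] at hXY
    field_simp
    linear_combination hXY

theorem isSquare_div_of_not_isSquare {a b : F} (ha : ¬ IsSquare a) (hb : ¬ IsSquare b) :
    IsSquare (a / b) := by
  classical
  have := Fintype.ofFinite F
  have h0 : b ≠ 0 := by rintro rfl; exact hb IsSquare.zero
  have ha0 : a ≠ 0 := by rintro rfl; exact ha IsSquare.zero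
  rw [← quadraticChar_neg_one_iff_not_isSquare] at ha hb
  obtain ⟨r, hr⟩ := (quadraticChar_one_iff_isSquare (mul_ne_zero ha0 h0)).1
    (show quadraticChar F (a * b) = 1 by rw [map_mul, ha, hb]; norm_num)
  exact ⟨r / b, by field_simp; linear_combination hr⟩

theorem classes_trace_of_ne (hF : ringChar F ≠ 2) {t : F} (h : t ^ 2 - 4 ≠ 0) :
    {C : ConjClasses (SL2 F) | classTrace C = t} =
      {ConjClasses.mk (companionSL 1 t one_ne_zero)} := by
  ext C
  obtain ⟨g, rfl⟩ := ConjClasses.mk_surjective C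
  simp only [Set.mem_ofPred_eq, classTrace_mk, Set.mem_singleton_iff]
  constructor
  · rintro rfl
    obtain ⟨x, y, hxy⟩ := exists_cyclicForm_eq_one hF h
    exact (ConjClasses.mk_eq_mk_iff_isConj.2 (isConj_companionSL one_ne_zero hxy)).symm
  · intro H
    simpa using slTrace_eq_of_isConj (ConjClasses.mk_eq_mk_iff_isConj.1 H)

theorem ncard_classes_trace (hF : ringChar F ≠ 2) {t : F} (h : t ^ 2 - 4 ≠ 0) :
    {C : ConjClasses (SL2 F) | classTrace C = t}.ncard = 1 := by
  rw [classes_trace_of_ne hF h, Set.ncard_singleton]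

/-- The scalar matrix `e` with `e ^ 2 = 1`. -/
def scalarSL (e : F) (he : e ^ 2 = 1) : SL2 F :=
  slOf e 0 0 e (by linear_combination he)

/-- A non-scalar g is conjugate to a companion matrix with parameter d, and rescaling v changes d by
squares, leaving d = 1 or a fixed nonsquare n. The scalar t/2 gives the third class. -/
theorem ncard_classes_trace_of_eq (hF : ringChar F ≠ 2) {t : F} (h : t ^ 2 = 4) :
    {C : ConjClasses (SL2 F) | classTrace C = t}.ncard = 3 := by
  have h2 : (2 : F) ≠ 0 := Ring.two_ne_zero hF
  obtain ⟨n, hn⟩ := FiniteField.exists_nonsquare hF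
  have hn0 : n ≠ 0 := by rintro rfl; exact hn (IsSquare.zero)
  have he : (t / 2) ^ 2 = 1 := by field_simp; linear_combination h
  have hsc : ∀ (d : F) (hd : d ≠ 0), ¬ IsConj (scalarSL (t / 2) he) (companionSL d t hd) := by
    intro d hd H
    obtain ⟨x, hx⟩ := isConj_iff.1 H
    rw [mul_inv_eq_iff_eq_mul] at hx
    have e00 := congrArg (fun g : SL2 F => g.1 0 0) hx
    have e10 := congrArg (fun g : SL2 F => g.1 1 0) hx
    have e01 := congrArg (fun g : SL2 F => g.1 0 1) hx
    have hdt := sl2_det x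
    simp [companionSL, scalarSL, sl2_mul_entry] at e00 e10 e01
    field_simp at e00 e10 e01
    have a : x.1 1 0 * 2 = - (x.1 0 0 * t * d) := by linear_combination e00
    have b : x.1 1 1 * 2 = - (x.1 0 1 * t * d) := by linear_combination e01
    -- The rows of the intertwiner are proportional, against determinant 1.
    have : (2 : F) = 0 := by
      linear_combination -2 * hdt + x.1 0 0 * b - x.1 0 1 * a
    exact h2 this
  have key : {C : ConjClasses (SL2 F) | classTrace C = t} =
      {ConjClasses.mk (scalarSL (t / 2) he), ConjClasses.mk (companionSL 1 t one_ne_zero),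
        ConjClasses.mk (companionSL n t hn0)} := by
    ext C
    obtain ⟨g, rfl⟩ := ConjClasses.mk_surjective C
    simp only [Set.mem_ofPred_eq, classTrace_mk, Set.mem_insert_iff, Set.mem_singleton_iff]
    constructor
    · intro hg
      by_cases hs : g.1 1 0 = 0 ∧ g.1 0 1 = 0 ∧ g.1 0 0 = g.1 1 1
      · left
        congr 1
        obtain ⟨s1, s2, s3⟩ := hs
        have : g.1 0 0 = t / 2 := by rw [← hg, slTrace, ← s3]; field_simp; ring
        apply SL2.ext_entries <;> simp [scalarSL, s1, s2, ← s3, this]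
      · right
        subst hg
        obtain ⟨x, y, hxy⟩ := exists_cyclicForm_ne_zero hs
        by_cases hq : IsSquare (cyclicForm g x y)
        · left
          obtain ⟨r, hr⟩ := hq
          have hr0 : r ≠ 0 := by rintro rfl; simp [hr] at hxy
          refine (ConjClasses.mk_eq_mk_iff_isConj.2
            (isConj_companionSL (x := r⁻¹ * x) (y := r⁻¹ * y) one_ne_zero ?_)).symm
          rw [cyclicForm_smul, hr]; field_simp
        · right
          obtain ⟨r, hr⟩ := isSquare_div_of_not_isSquare hn hq
          refine (ConjClasses.mk_eq_mk_iff_isConj.2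
            (isConj_companionSL (x := r * x) (y := r * y) hn0 ?_)).symm
          rw [cyclicForm_smul]
          field_simp at hr
          linear_combination -hr
    · rintro (H | H | H)
      · rw [slTrace_eq_of_isConj (ConjClasses.mk_eq_mk_iff_isConj.1 H)]
        simp only [slTrace, scalarSL, slOf_zero_zero, slOf_one_one]
        field_simp
        ring
      · simpa using slTrace_eq_of_isConj (ConjClasses.mk_eq_mk_iff_isConj.1 H)
      · simpa using slTrace_eq_of_isConj (ConjClasses.mk_eq_mk_iff_isConj.1 H)
  rw [key]
  refine Set.ncard_eq_three.2 ⟨_, _, _, ?_, ?_, ?_, rfl⟩ <;>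
    rw [Ne, ConjClasses.mk_eq_mk_iff_isConj]
  · exact hsc _ _
  · exact hsc _ _
  · exact not_isConj_companionSL h2 h hn0 hn

end Conjugacy

/-! ### Counting the trace values, and assembling both counts -/

section TraceValues

variable {F : Type*} [Field F] [Fintype F] [DecidableEq F]

variable (F) in
/-- The traces `t` of fourth powers with `t ^ 2 - 4` of quadratic character `e`. -/
def quarticTraces (e : ℤ) : Finset F :=
  (univ.filter fun s : F => quadraticChar F (quarticTrace s ^ 2 - 4) = e).image quarticTrace

theorem mem_quarticTraces {e : ℤ} {t : F} :
    t ∈ quarticTraces F e ↔ (∃ s, quarticTrace s = t) ∧ quadraticChar F (t ^ 2 - 4) = e := by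
  simp only [quarticTraces, mem_image, mem_filter, mem_univ, true_and]
  constructor
  · rintro ⟨s, h, rfl⟩; exact ⟨⟨s, rfl⟩, h⟩
  · rintro ⟨⟨s, rfl⟩, h⟩; exact ⟨s, h, rfl⟩

/-- Q(x) − Q(s) = (x² − s²)(x² − (4 − s²)). The first factor has two roots, the second 1 + χ(4 −
s²), and they share none because s² ≠ 2. -/
theorem card_quarticTrace_fiber (hF : ringChar F ≠ 2) {s : F} (h : quarticTrace s ^ 2 - 4 ≠ 0) :
    ((univ.filter fun x : F => quarticTrace x = quarticTrace s).card : ℤ) =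
      3 + quadraticChar F (-1) * quadraticChar F (quarticTrace s ^ 2 - 4) := by
  have h2 : (2 : F) ≠ 0 := Ring.two_ne_zero hF
  rw [quarticTrace_sq_sub_four] at h ⊢
  have hk := (pow_ne_zero_iff two_ne_zero).1 (left_ne_zero_of_mul h)
  have hs0 : s ≠ 0 := by rintro rfl; simp at hk
  have hs2 : s ^ 2 ≠ 2 := fun e => hk (by linear_combination s * e)
  have e : (univ.filter fun x : F => quarticTrace x = quarticTrace s) =
      (univ.filter fun x : F => x ^ 2 = s ^ 2) ∪ (univ.filter fun x : F => x ^ 2 = 4 - s ^ 2) := by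
    ext x
    simp only [mem_filter, mem_univ, true_and, mem_union]
    have : quarticTrace x = quarticTrace s ↔ (x ^ 2 - s ^ 2) * (x ^ 2 - (4 - s ^ 2)) = 0 := by
      rw [← sub_eq_zero]
      unfold quarticTrace
      constructor <;> intro h <;> linear_combination h
    rw [this, mul_eq_zero, sub_eq_zero, sub_eq_zero]
  rw [e, card_union_of_disjoint, Nat.cast_add, card_sqrt hF, card_sqrt hF,
    quadraticChar_sq_one' hs0, map_mul, quadraticChar_sq_one' hk,
    show 4 - s ^ 2 = -1 * (s ^ 2 - 4) by ring, map_mul]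
  · ring
  · rw [Finset.disjoint_filter]
    intro x _ h1 h3
    apply hs2
    have : (2 : F) * (s ^ 2 - 2) = 0 := by linear_combination h3 - h1
    rcases mul_eq_zero.1 this with h | h
    · exact absurd h h2
    · linear_combination h

theorem card_filter_quadraticChar (hF : ringChar F ≠ 2) {e : ℤ} (he : e = 1 ∨ e = -1) :
    2 * ((univ.filter fun s : F => quadraticChar F (s ^ 2 - 4) = e).card : ℤ) =
      Fintype.card F - 2 - e := by
  have h2 : (2 : F) ≠ 0 := Ring.two_ne_zero hF
  have h0 : ((univ.filter fun s : F => s ^ 2 - 4 = 0).card : ℤ) = 2 := by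
    simp_rw [sub_eq_zero]
    rw [card_sqrt hF, show (4 : F) = 2 ^ 2 by norm_num, quadraticChar_sq_one' h2]
    norm_num
  -- For e = ±1 the indicator of χ = e is (1 + eχ)/2 wherever χ is nonzero.
  have pt : ∀ s : F, 2 * (if quadraticChar F (s ^ 2 - 4) = e then (1 : ℤ) else 0) =
      1 - (if s ^ 2 - 4 = 0 then 1 else 0) + e * quadraticChar F (s ^ 2 - 4) := by
    intro s
    by_cases h : s ^ 2 - 4 = 0
    · rcases he with rfl | rfl <;> simp [h]
    · rcases quadraticChar_dichotomy h with h' | h' <;> rcases he with rfl | rfl <;> simp [h, h']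
  have := Finset.sum_congr rfl fun (s : F) (_ : s ∈ univ) => pt s
  rw [← Finset.mul_sum, Finset.sum_add_distrib, Finset.sum_sub_distrib, ← Finset.mul_sum,
    sum_quadraticChar_sq_sub_four hF, ← Finset.sum_filter, ← Finset.sum_filter] at this
  simp only [Finset.sum_const, nsmul_eq_mul, mul_one, h0, Finset.card_univ] at this
  linarith

theorem card_cubic_roots (hF : ringChar F ≠ 2) :
    ((univ.filter fun s : F => s ^ 3 - 2 * s = 0).card : ℤ) = 2 + quadraticChar F 2 := by
  have h2 : (2 : F) ≠ 0 := Ring.two_ne_zero hF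
  have e : (univ.filter fun s : F => s ^ 3 - 2 * s = 0) =
      insert 0 (univ.filter fun s : F => s ^ 2 = 2) := by
    ext s
    simp only [mem_filter, mem_univ, true_and, mem_insert]
    rw [show s ^ 3 - 2 * s = s * (s ^ 2 - 2) by ring, mul_eq_zero, sub_eq_zero]
  rw [e, card_insert_of_notMem (by simp [h2.symm]), Nat.cast_add, card_sqrt hF]
  push_cast; ring

theorem quadraticChar_cubic_root (hF : ringChar F ≠ 2) {s : F} (h : s ^ 3 - 2 * s = 0) :
    quadraticChar F (s ^ 2 - 4) = quadraticChar F (-1) := by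
  have h2 : (2 : F) ≠ 0 := Ring.two_ne_zero hF
  by_cases hs : s = 0
  · rw [hs, show (0 : F) ^ 2 - 4 = -1 * 2 ^ 2 by norm_num, map_mul, quadraticChar_sq_one' h2,
      mul_one]
  · have : s ^ 2 = 2 := mul_left_cancel₀ hs (by linear_combination h)
    rw [show s ^ 2 - 4 = -1 * s ^ 2 by linear_combination 2 * this, map_mul,
      quadraticChar_sq_one' hs, mul_one]

/-- Double count of `S`: by fibres of Q, and as the s with χ(s² − 4) = e less the roots of s³ − 2s.
All those roots have χ(s² − 4) = χ(−1), so (1 + χ(−1)e)/2 tells whether they are removed. -/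
theorem card_quarticTraces (hF : ringChar F ≠ 2) {e : ℤ} (he : e = 1 ∨ e = -1) :
    2 * (3 + quadraticChar F (-1) * e) * ((quarticTraces F e).card : ℤ) =
      Fintype.card F - 2 - e - (1 + quadraticChar F (-1) * e) * (2 + quadraticChar F 2) := by
  have hne : e ≠ 0 := by rcases he with rfl | rfl <;> norm_num
  set S := univ.filter fun s : F => quadraticChar F (quarticTrace s ^ 2 - 4) = e with hS
  have hST : (S.card : ℤ) = (3 + quadraticChar F (-1) * e) * (quarticTraces F e).card := by
    rw [Finset.card_eq_sum_card_image quarticTrace S, Nat.cast_sum, Finset.sum_congr rfl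
      (g := fun _ => 3 + quadraticChar F (-1) * e), Finset.sum_const, nsmul_eq_mul, mul_comm]
    · rfl
    · intro t ht
      obtain ⟨s, hs, rfl⟩ := mem_image.1 ht
      have hs' := (mem_filter.1 hs).2
      rw [← hs', ← card_quarticTrace_fiber hF]
      · congr 2
        ext x
        simp only [hS, mem_filter, mem_univ, true_and]
        exact ⟨fun h => h.2, fun h => ⟨by rw [h, hs'], h⟩⟩
      · intro h0
        rw [h0, quadraticChar_zero] at hs'
        exact hne hs'.symm
  have hd : quadraticChar F (-1) = 1 ∨ quadraticChar F (-1) = -1 :=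
    quadraticChar_dichotomy (neg_ne_zero.2 one_ne_zero)
  have hA := card_filter_quadraticChar hF he
  rw [← Finset.card_filter_add_card_filter_not (s := univ.filter fun s : F =>
    quadraticChar F (s ^ 2 - 4) = e) (fun s => s ^ 3 - 2 * s = 0), filter_filter,
    filter_filter] at hA
  have h1 : S = univ.filter fun s : F =>
      quadraticChar F (s ^ 2 - 4) = e ∧ ¬ s ^ 3 - 2 * s = 0 := by
    ext s
    simp only [hS, mem_filter, mem_univ, true_and, quarticTrace_sq_sub_four, map_mul]
    by_cases h : s ^ 3 - 2 * s = 0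
    · simp [h, hne.symm]
    · simp [h, quadraticChar_sq_one' h]
  have h3 : 2 * ((univ.filter fun s : F =>
      quadraticChar F (s ^ 2 - 4) = e ∧ s ^ 3 - 2 * s = 0).card : ℤ) =
      (1 + quadraticChar F (-1) * e) * (2 + quadraticChar F 2) := by
    by_cases hde : quadraticChar F (-1) = e
    · rw [← card_cubic_roots hF, hde, show 1 + e * e = 2 by rcases he with rfl | rfl <;> norm_num]
      congr 3
      ext s
      simp only [mem_filter, mem_univ, true_and, and_iff_right_iff_imp]
      exact fun h => (quadraticChar_cubic_root hF h).trans hde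
    · rw [show 1 + quadraticChar F (-1) * e = 0 by
        rcases he with rfl | rfl <;> rcases hd with h | h <;> simp_all, Finset.filter_false_of_mem]
      · simp
      · rintro s - ⟨h, h'⟩
        exact hde ((quadraticChar_cubic_root hF h').symm.trans h)
  rw [← h1] at hA
  push_cast at hA
  linear_combination hA - h3 - 2 * hST

/-- Bookkeeping shared by the matrix count and the class count, which differ only in the weight
given to each trace. -/
theorem sum_over_traces (hF : ringChar F ≠ 2) {f : F → ℤ} {A B a b : ℤ} (h2 : f 2 = A)
    (hm2 : f (-2) = B) (hp : ∀ t ∈ quarticTraces F 1, f t = a)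
    (hm : ∀ t ∈ quarticTraces F (-1), f t = b)
    (h0 : ∀ t, t ^ 2 - 4 ≠ 0 → (¬ ∃ s, quarticTrace s = t) → f t = 0) :
    ∑ t, f t = A + B + a * (quarticTraces F 1).card + b * (quarticTraces F (-1)).card := by
  have ht : (2 : F) ≠ 0 := Ring.two_ne_zero hF
  have hne : (2 : F) ≠ -2 := fun h => four_ne_zero_of_two ht (by linear_combination h)
  have pt : ∀ t, f t = (if t = 2 then A else 0) + (if t = -2 then B else 0) +
      (if t ∈ quarticTraces F 1 then a else 0) + (if t ∈ quarticTraces F (-1) then b else 0) := by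
    intro t
    have z : ∀ t : F, t ^ 2 - 4 = 0 → ∀ e : ℤ, e ≠ 0 → t ∉ quarticTraces F e := by
      intro t h e he hm
      rw [mem_quarticTraces, h, quadraticChar_zero] at hm
      exact he hm.2.symm
    by_cases h : t ^ 2 - 4 = 0
    · rw [if_neg (z t h 1 (by norm_num)), if_neg (z t h (-1) (by norm_num))]
      have : (t - 2) * (t + 2) = 0 := by linear_combination h
      rcases mul_eq_zero.1 this with h | h
      · rw [sub_eq_zero.1 h, if_pos rfl, if_neg hne, h2]; ring
      · rw [eq_neg_of_add_eq_zero_left h, if_pos rfl, if_neg hne.symm, hm2]; ring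
    · rw [if_neg (by rintro rfl; apply h; norm_num), if_neg (by rintro rfl; apply h; norm_num)]
      by_cases hx : ∃ s, quarticTrace s = t
      · rcases quadraticChar_dichotomy h with h' | h'
        · rw [hp t (mem_quarticTraces.2 ⟨hx, h'⟩), if_pos (mem_quarticTraces.2 ⟨hx, h'⟩), if_neg]
          · ring
          · intro hh; rw [mem_quarticTraces, h'] at hh; norm_num at hh
        · rw [hm t (mem_quarticTraces.2 ⟨hx, h'⟩), if_pos (mem_quarticTraces.2 ⟨hx, h'⟩), if_neg]
          · ring
          · intro hh; rw [mem_quarticTraces, h'] at hh; norm_num at hh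
      · rw [h0 t h hx, if_neg fun hh => hx (mem_quarticTraces.1 hh).1,
          if_neg fun hh => hx (mem_quarticTraces.1 hh).1]
        ring
  simp only [Finset.sum_congr rfl fun t _ => pt t, Finset.sum_add_distrib, Finset.sum_ite_eq',
    Finset.sum_ite_mem, univ_inter, mem_univ, if_true, Finset.sum_const, nsmul_eq_mul]
  ring

theorem ne_zero_of_mem_quarticTraces {e : ℤ} (he : e ≠ 0) {t : F} (h : t ∈ quarticTraces F e) :
    t ^ 2 - 4 ≠ 0 := by
  intro h0
  rw [mem_quarticTraces, h0, quadraticChar_zero] at h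
  exact he h.2.symm

theorem ncard_fourthPowers_trace (hF : ringChar F ≠ 2) {e : ℤ} (he : e ≠ 0) {t : F}
    (h : t ∈ quarticTraces F e) :
    ({g : SL2 F | g ∈ nthPowers (SL2 F) 4 ∧ slTrace g = t}.ncard : ℤ) =
      (Fintype.card F : ℤ) ^ 2 + Fintype.card F * e := by
  have h0 := ne_zero_of_mem_quarticTraces he h
  obtain ⟨hx, hc⟩ := mem_quarticTraces.1 h
  rw [← hc, ← ncard_trace_eq hF]
  congr 2
  ext g
  refine and_iff_right_of_imp ?_
  rintro rfl
  exact (mem_nthPowers_four_iff_of_trace_ne h0).2 hx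

theorem powerCount_four (hF : ringChar F ≠ 2) :
    (powerCount 4 F : ℤ) = (Fintype.card F : ℤ) ^ 2 + (if IsSquare (2 : F) then 1 else 0) +
      ((Fintype.card F : ℤ) ^ 2 + Fintype.card F) * (quarticTraces F 1).card +
      ((Fintype.card F : ℤ) ^ 2 - Fintype.card F) * (quarticTraces F (-1)).card := by
  have h2 : (2 : F) ≠ 0 := Ring.two_ne_zero hF
  rw [powerCount, ncard_eq_sum_fiber _ slTrace, Nat.cast_sum]
  refine sum_over_traces hF ?_ ?_ ?_ ?_ ?_
  · have := ncard_trace_eq hF (2 : F)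
    rw [show (2 : F) ^ 2 - 4 = 0 by norm_num, quadraticChar_zero, mul_zero, add_zero] at this
    rw [← this]
    congr 2
    ext g
    exact and_iff_right_of_imp fun h => mem_nthPowers_four_of_trace_two h2 h
  · split_ifs with hs
    · rw [show {g : SL2 F | g ∈ nthPowers (SL2 F) 4 ∧ slTrace g = -2} = {-1} from ?_]
      · simp
      · ext g
        constructor
        · exact fun h => (eq_neg_one_of_mem_nthPowers_four h.1 h.2).1
        · rintro rfl
          exact ⟨neg_one_mem_nthPowers_four hs, slTrace_neg_one⟩
    · rw [show {g : SL2 F | g ∈ nthPowers (SL2 F) 4 ∧ slTrace g = -2} = ∅ from ?_]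
      · simp
      · ext g
        simp only [Set.mem_empty_iff_false, iff_false]
        exact fun h => hs (eq_neg_one_of_mem_nthPowers_four h.1 h.2).2
  · intro t ht
    rw [ncard_fourthPowers_trace hF (by norm_num) ht]; ring
  · intro t ht
    rw [ncard_fourthPowers_trace hF (by norm_num) ht]; ring
  · intro t h0 hx
    rw [show {g : SL2 F | g ∈ nthPowers (SL2 F) 4 ∧ slTrace g = t} = ∅ from ?_]
    · simp
    · ext g
      simp only [Set.mem_empty_iff_false, iff_false]
      rintro ⟨h, rfl⟩
      exact hx ((mem_nthPowers_four_iff_of_trace_ne h0).1 h)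

theorem ncard_fourthPowerClasses_trace (hF : ringChar F ≠ 2) {e : ℤ} (he : e ≠ 0) {t : F}
    (h : t ∈ quarticTraces F e) :
    {C | C ∈ nthPowerClasses (SL2 F) 4 ∧ classTrace C = t}.ncard = 1 := by
  have h0 := ne_zero_of_mem_quarticTraces he h
  rw [← ncard_classes_trace hF h0]
  congr 1
  ext C
  obtain ⟨g, rfl⟩ := ConjClasses.mk_surjective C
  refine and_iff_right_of_imp ?_
  rintro rfl
  exact mk_mem_nthPowerClasses.2
    ((mem_nthPowers_four_iff_of_trace_ne h0).2 (mem_quarticTraces.1 h).1)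

theorem powerClassCount_four (hF : ringChar F ≠ 2) :
    (powerClassCount 4 F : ℤ) = 3 + (if IsSquare (2 : F) then 1 else 0) +
      1 * (quarticTraces F 1).card + 1 * (quarticTraces F (-1)).card := by
  have h2 : (2 : F) ≠ 0 := Ring.two_ne_zero hF
  rw [powerClassCount, ncard_eq_sum_fiber _ classTrace, Nat.cast_sum]
  refine sum_over_traces hF ?_ ?_ ?_ ?_ ?_
  · rw [← Nat.cast_ofNat (R := ℤ) (n := 3),
      ← ncard_classes_trace_of_eq hF (show (2 : F) ^ 2 = 4 by norm_num)]
    congr 2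
    ext C
    obtain ⟨g, rfl⟩ := ConjClasses.mk_surjective C
    exact and_iff_right_of_imp fun h =>
      mk_mem_nthPowerClasses.2 (mem_nthPowers_four_of_trace_two h2 h)
  · split_ifs with hs
    · rw [show {C | C ∈ nthPowerClasses (SL2 F) 4 ∧ classTrace C = -2} =
        {ConjClasses.mk (-1)} from ?_]
      · simp
      · ext C
        constructor
        · obtain ⟨g, rfl⟩ := ConjClasses.mk_surjective C
          rintro ⟨h, h'⟩
          rw [(eq_neg_one_of_mem_nthPowers_four (mk_mem_nthPowerClasses.1 h) h').1]
          rfl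
        · rintro rfl
          exact ⟨mk_mem_nthPowerClasses.2 (neg_one_mem_nthPowers_four hs), slTrace_neg_one⟩
    · rw [show {C | C ∈ nthPowerClasses (SL2 F) 4 ∧ classTrace C = -2} = ∅ from ?_]
      · simp
      · ext C
        obtain ⟨g, rfl⟩ := ConjClasses.mk_surjective C
        simp only [Set.mem_empty_iff_false, iff_false]
        exact fun h => hs (eq_neg_one_of_mem_nthPowers_four (mk_mem_nthPowerClasses.1 h.1) h.2).2
  · intro t ht
    rw [ncard_fourthPowerClasses_trace hF (by norm_num) ht]; rfl
  · intro t ht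
    rw [ncard_fourthPowerClasses_trace hF (by norm_num) ht]; rfl
  · intro t h0 hx
    rw [show {C | C ∈ nthPowerClasses (SL2 F) 4 ∧ classTrace C = t} = ∅ from ?_]
    · simp
    · ext C
      obtain ⟨g, rfl⟩ := ConjClasses.mk_surjective C
      simp only [Set.mem_empty_iff_false, iff_false]
      rintro ⟨h, rfl⟩
      exact hx ((mem_nthPowers_four_iff_of_trace_ne h0).1 (mk_mem_nthPowerClasses.1 h))

theorem natCard_conjClasses_SL2 (hF : ringChar F ≠ 2) :
    (Nat.card (ConjClasses (SL2 F)) : ℤ) = Fintype.card F + 4 := by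
  have h2 : (2 : F) ≠ 0 := Ring.two_ne_zero hF
  have hc : ((univ.filter fun t : F => t ^ 2 = 4).card : ℤ) = 2 := by
    rw [card_sqrt hF, show (4 : F) = 2 ^ 2 by norm_num, quadraticChar_sq_one' h2]
    norm_num
  rw [← Set.ncard_univ, ncard_eq_sum_fiber _ classTrace, Nat.cast_sum]
  simp only [Set.mem_univ, true_and]
  have pt : ∀ t : F, ({C : ConjClasses (SL2 F) | classTrace C = t}.ncard : ℤ) =
      1 + if t ^ 2 = 4 then 2 else 0 := by
    intro t
    split_ifs with h
    · rw [ncard_classes_trace_of_eq hF h]; rfl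
    · rw [ncard_classes_trace hF (sub_ne_zero.2 h)]; rfl
  rw [Finset.sum_congr rfl fun t _ => pt t, Finset.sum_add_distrib, ← Finset.sum_filter,
    Finset.sum_const, Finset.sum_const, nsmul_eq_mul, nsmul_eq_mul, hc, Finset.card_univ]
  ring

end TraceValues

/-! ### Residues of q modulo 8 and the limits -/

section Formulas

variable {F : Type*} [Field F] [Finite F]

theorem ringChar_ne_two_of_odd_card (h : Odd (Nat.card F)) : ringChar F ≠ 2 := by
  have := Fintype.ofFinite F
  intro h2
  have := FiniteField.even_card_of_char_two h2
  rw [Nat.card_eq_fintype_card, Nat.odd_iff] at h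
  omega

/-- The numbers of trace values of fourth powers, split and nonsplit, with the formulas for
both counts in terms of them. -/
theorem powerCount_four_formula (h : Odd (Nat.card F)) : ∃ m n : ℤ,
    (powerCount 4 F : ℤ) = (Nat.card F : ℤ) ^ 2 +
      (if Nat.card F % 8 = 1 ∨ Nat.card F % 8 = 7 then 1 else 0) +
      ((Nat.card F : ℤ) ^ 2 + Nat.card F) * m + ((Nat.card F : ℤ) ^ 2 - Nat.card F) * n ∧
    (powerClassCount 4 F : ℤ) = 3 +
      (if Nat.card F % 8 = 1 ∨ Nat.card F % 8 = 7 then 1 else 0) + m + n ∧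
    (Nat.card F % 8 = 1 → 8 * m = Nat.card F - 9 ∧ 4 * n = Nat.card F - 1) ∧
    (Nat.card F % 8 = 3 → 4 * m = Nat.card F - 3 ∧ 8 * n = Nat.card F - 3) ∧
    (Nat.card F % 8 = 5 → 8 * m = Nat.card F - 5 ∧ 4 * n = Nat.card F - 1) ∧
    (Nat.card F % 8 = 7 → 4 * m = Nat.card F - 3 ∧ 8 * n = Nat.card F - 7) := by
  classical
  have := Fintype.ofFinite F
  have hF := ringChar_ne_two_of_odd_card h
  have h2 : (2 : F) ≠ 0 := Ring.two_ne_zero hF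
  have hm := card_quarticTraces hF (e := 1) (Or.inl rfl)
  have hn := card_quarticTraces hF (e := -1) (Or.inr rfl)
  have hs := powerCount_four hF
  have hc := powerClassCount_four hF
  have i2 := FiniteField.isSquare_two_iff (F := F)
  have i1 := FiniteField.isSquare_neg_one_iff (F := F)
  rw [← quadraticChar_one_iff_isSquare h2] at i2
  rw [← quadraticChar_one_iff_isSquare (neg_ne_zero.2 one_ne_zero)] at i1
  have d2 := quadraticChar_dichotomy h2
  have d1 := quadraticChar_dichotomy (neg_ne_zero.2 (one_ne_zero (α := F)))
  rw [← Nat.card_eq_fintype_card] at *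
  rw [Nat.odd_iff] at h
  have i2' : IsSquare (2 : F) ↔ Nat.card F % 8 = 1 ∨ Nat.card F % 8 = 7 := by
    rw [← quadraticChar_one_iff_isSquare h2, i2]; omega
  simp only [i2'] at hs hc
  -- The residue of q modulo 8 fixes χ(−1) and χ(2), after which `hm` and `hn` are linear in the two
  -- cardinalities.
  refine ⟨_, _, hs, by rw [hc]; ring, ?_, ?_, ?_, ?_⟩ <;> intro hq
  · rw [i1.2 (by omega), i2.2 (by omega)] at hm hn
    constructor <;> linarith
  · rw [d1.resolve_left fun h => by have := i1.1 h; omega,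
      d2.resolve_left fun h => by have := i2.1 h; omega] at hm hn
    constructor <;> linarith
  · rw [i1.2 (by omega), d2.resolve_left fun h => by have := i2.1 h; omega] at hm hn
    constructor <;> linarith
  · rw [d1.resolve_left fun h => by have := i1.1 h; omega, i2.2 (by omega)] at hm hn
    constructor <;> linarith

theorem powerCount_four_rat (h : Odd (Nat.card F)) :
    (Nat.card F % 8 = 1 → (powerCount 4 F : ℚ) =
      3 / 8 * (Nat.card F : ℚ) ^ 3 - 1 / 2 * (Nat.card F : ℚ) ^ 2 - 7 / 8 * (Nat.card F : ℚ) + 1) ∧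
    (Nat.card F % 8 = 3 ∨ Nat.card F % 8 = 5 → (powerCount 4 F : ℚ) =
      3 / 8 * ((Nat.card F : ℚ) ^ 3 - (Nat.card F : ℚ))) ∧
    (Nat.card F % 8 = 7 → (powerCount 4 F : ℚ) =
      3 / 8 * (Nat.card F : ℚ) ^ 3 - 1 / 2 * (Nat.card F : ℚ) ^ 2 + 1 / 8 * (Nat.card F : ℚ) + 1)
    := by
  obtain ⟨m, n, hs, -, h1, h3, h5, h7⟩ := powerCount_four_formula h
  have hs' : (powerCount 4 F : ℚ) = (Nat.card F : ℚ) ^ 2 +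
      (if Nat.card F % 8 = 1 ∨ Nat.card F % 8 = 7 then 1 else 0) +
      ((Nat.card F : ℚ) ^ 2 + Nat.card F) * m + ((Nat.card F : ℚ) ^ 2 - Nat.card F) * n := by
    exact_mod_cast congrArg (Int.cast : ℤ → ℚ) hs
  have q : ∀ {k l a : ℤ}, k * l = Nat.card F - a → (k : ℚ) * l = Nat.card F - a := fun h => by
    exact_mod_cast congrArg (Int.cast : ℤ → ℚ) h
  generalize Nat.card F = c at *
  refine ⟨fun hq => ?_, ?_, fun hq => ?_⟩
  · obtain ⟨e1, e2⟩ := h1 hq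
    replace e1 := q e1
    replace e2 := q e2
    push_cast at e1 e2
    rw [hs', if_pos (by omega)]
    linear_combination ((c : ℚ) ^ 2 + c) / 8 * e1 + ((c : ℚ) ^ 2 - c) / 4 * e2
  · rintro (hq | hq)
    · obtain ⟨e1, e2⟩ := h3 hq
      replace e1 := q e1
      replace e2 := q e2
      push_cast at e1 e2
      rw [hs', if_neg (by omega)]
      linear_combination ((c : ℚ) ^ 2 + c) / 4 * e1 + ((c : ℚ) ^ 2 - c) / 8 * e2
    · obtain ⟨e1, e2⟩ := h5 hq
      replace e1 := q e1
      replace e2 := q e2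
      push_cast at e1 e2
      rw [hs', if_neg (by omega)]
      linear_combination ((c : ℚ) ^ 2 + c) / 8 * e1 + ((c : ℚ) ^ 2 - c) / 4 * e2
  · obtain ⟨e1, e2⟩ := h7 hq
    replace e1 := q e1
    replace e2 := q e2
    push_cast at e1 e2
    rw [hs', if_pos (by omega)]
    linear_combination ((c : ℚ) ^ 2 + c) / 4 * e1 + ((c : ℚ) ^ 2 - c) / 8 * e2

theorem eight_mul_powerClassCount_four (h : Odd (Nat.card F)) :
    (Nat.card F % 8 = 1 → 8 * powerClassCount 4 F = 3 * Nat.card F + 21) ∧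
    (Nat.card F % 8 = 3 → 8 * powerClassCount 4 F = 3 * Nat.card F + 15) ∧
    (Nat.card F % 8 = 5 → 8 * powerClassCount 4 F = 3 * Nat.card F + 17) ∧
    (Nat.card F % 8 = 7 → 8 * powerClassCount 4 F = 3 * Nat.card F + 19) := by
  obtain ⟨m, n, -, hc, h1, h3, h5, h7⟩ := powerCount_four_formula h
  refine ⟨fun hq => ?_, fun hq => ?_, fun hq => ?_, fun hq => ?_⟩
  · have := h1 hq
    rw [if_pos (by omega)] at hc
    omega
  · have := h3 hq
    rw [if_neg (by omega)] at hc
    omega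
  · have := h5 hq
    rw [if_neg (by omega)] at hc
    omega
  · have := h7 hq
    rw [if_pos (by omega)] at hc
    omega

theorem mod_eight_of_odd {q : ℕ} (h : Odd q) : q % 8 = 1 ∨ q % 8 = 3 ∨ q % 8 = 5 ∨ q % 8 = 7 := by
  rw [Nat.odd_iff] at h
  omega

theorem abs_powerCount_four_div_sub_lt (h : Odd (Nat.card F)) {ε : ℝ} (hε : 0 < ε)
    (hN : ⌈2 / ε⌉₊ + 2 ≤ Nat.card F) :
    |(powerCount 4 F : ℝ) / (Nat.card (SL2 F) : ℝ) - 3 / 8| < ε := by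
  classical
  have := Fintype.ofFinite F
  have hcard := natCard_SL2 (ringChar_ne_two_of_odd_card h)
  rw [← Nat.card_eq_fintype_card] at hcard
  have hs := powerCount_four_rat h
  have h8 := mod_eight_of_odd h
  have hεq : 2 / ε + 2 ≤ (Nat.card F : ℝ) := by
    have : ((⌈2 / ε⌉₊ + 2 : ℕ) : ℝ) ≤ Nat.card F := by exact_mod_cast hN
    push_cast at this
    linarith [Nat.le_ceil (2 / ε)]
  have hcard' : (Nat.card (SL2 F) : ℝ) = (Nat.card F : ℝ) ^ 3 - Nat.card F := by
    exact_mod_cast congrArg (Int.cast : ℤ → ℝ) hcard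
  have hε' : 0 < 2 / ε := by positivity
  have hq2 : (2 : ℝ) < Nat.card F := by linarith
  have bound : |(powerCount 4 F : ℝ) - 3 / 8 * ((Nat.card F : ℝ) ^ 3 - Nat.card F)| ≤
      (Nat.card F : ℝ) ^ 2 := by
    obtain ⟨h1, h35, h7⟩ := hs
    have r : ∀ {x : ℚ}, (powerCount 4 F : ℚ) = x → (powerCount 4 F : ℝ) = (x : ℝ) := fun h => by
      exact_mod_cast congrArg (Rat.cast : ℚ → ℝ) h
    rw [abs_le]
    rcases h8 with hq | hq | hq | hq
    · have := r (h1 hq)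
      push_cast at this
      rw [this]
      constructor <;> nlinarith
    · have := r (h35 (Or.inl hq))
      push_cast at this
      rw [this]
      constructor <;> nlinarith
    · have := r (h35 (Or.inr hq))
      push_cast at this
      rw [this]
      constructor <;> nlinarith
    · have := r (h7 hq)
      push_cast at this
      rw [this]
      constructor <;> nlinarith
  rw [hcard']
  generalize (Nat.card F : ℝ) = c at *
  have hpos : 0 < c ^ 3 - c := by nlinarith [mul_pos (show 0 < c by linarith) (show 0 < c - 2 by linarith)]
  rw [div_sub' hpos.ne', abs_div, abs_of_pos hpos, div_lt_iff₀ hpos]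
  -- Multiplied by c² − 1 this gives ε(c³ − c) ≥ (2 + 2ε)(c² − 1), which exceeds c² since c > 2.
  have hce : 2 + 2 * ε ≤ c * ε := by
    have := mul_le_mul_of_nonneg_right hεq hε.le
    rwa [add_mul, div_mul_cancel₀ _ hε.ne'] at this
  calc _ = |(powerCount 4 F : ℝ) - 3 / 8 * (c ^ 3 - c)| := by congr 1; ring
    _ ≤ c ^ 2 := bound
    _ < ε * (c ^ 3 - c) := by nlinarith [mul_le_mul_of_nonneg_right hce (show 0 ≤ c ^ 2 - 1 by nlinarith)]

theorem abs_powerClassCount_four_div_sub_lt (h : Odd (Nat.card F)) {ε : ℝ} (hε : 0 < ε)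
    (hN : ⌈2 / ε⌉₊ ≤ Nat.card F) :
    |(powerClassCount 4 F : ℝ) / (Nat.card (ConjClasses (SL2 F)) : ℝ) - 3 / 8| < ε := by
  classical
  have := Fintype.ofFinite F
  have hcard := natCard_conjClasses_SL2 (ringChar_ne_two_of_odd_card h)
  rw [← Nat.card_eq_fintype_card] at hcard
  have hs := eight_mul_powerClassCount_four h
  have h8 := mod_eight_of_odd h
  have hcard' : (Nat.card (ConjClasses (SL2 F)) : ℝ) = (Nat.card F : ℝ) + 4 := by
    exact_mod_cast congrArg (Int.cast : ℤ → ℝ) hcard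
  have hεq : 2 ≤ (Nat.card F : ℝ) * ε := (div_le_iff₀ hε).1 (Nat.ceil_le.1 hN)
  -- Since 3q + 12 = 3(q + 4), the count exceeds 3/8 of all classes by between 0 and 9/8, less than
  -- 2 ≤ qε.
  have l : 3 * Nat.card F + 12 ≤ 8 * powerClassCount 4 F := by omega
  have u : 8 * powerClassCount 4 F ≤ 3 * Nat.card F + 21 := by omega
  have l' : 3 * (Nat.card F : ℝ) + 12 ≤ 8 * powerClassCount 4 F := by exact_mod_cast l
  have u' : 8 * (powerClassCount 4 F : ℝ) ≤ 3 * Nat.card F + 21 := by exact_mod_cast u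
  have hpos : 0 < (Nat.card F : ℝ) + 4 := by positivity
  rw [hcard', div_sub' hpos.ne', abs_div, abs_of_pos hpos, div_lt_iff₀ hpos, abs_lt]
  constructor <;> nlinarith

end Formulas

end

theorem corollary7p7 :
    -- the exact formulas for `s(4, q)` and `c(4, q)`
    (∀ (F : Type*) [Field F] [Finite F] (q : ℕ), Nat.card F = q → Odd q →
      ((q % 8 = 1 →
          (powerCount 4 F : ℚ) = 3 / 8 * (q : ℚ) ^ 3 - 1 / 2 * (q : ℚ) ^ 2 - 7 / 8 * (q : ℚ) + 1) ∧
        (q % 8 = 3 ∨ q % 8 = 5 →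
          (powerCount 4 F : ℚ) = 3 / 8 * ((q : ℚ) ^ 3 - (q : ℚ))) ∧
        (q % 8 = 7 →
          (powerCount 4 F : ℚ) = 3 / 8 * (q : ℚ) ^ 3 - 1 / 2 * (q : ℚ) ^ 2 + 1 / 8 * (q : ℚ) + 1)) ∧
      ((q % 8 = 1 → (powerClassCount 4 F : ℚ) = (3 * (q : ℚ) + 21) / 8) ∧
        (q % 8 = 3 → (powerClassCount 4 F : ℚ) = (3 * (q : ℚ) + 15) / 8) ∧
        (q % 8 = 5 → (powerClassCount 4 F : ℚ) = (3 * (q : ℚ) + 17) / 8) ∧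
        (q % 8 = 7 → (powerClassCount 4 F : ℚ) = (3 * (q : ℚ) + 19) / 8))) ∧
    -- the proportion of fourth powers tends to `3 / 8` as the odd prime power `q` tends to infinity
    (∀ ε : ℝ, 0 < ε → ∃ N : ℕ, ∀ (F : Type*) [Field F] [Finite F],
      Odd (Nat.card F) → N ≤ Nat.card F →
        |(powerCount 4 F : ℝ) / (Nat.card (SL2 F) : ℝ) - 3 / 8| < ε) ∧
    -- so does the proportion of conjugacy classes that are fourth powers
    (∀ ε : ℝ, 0 < ε → ∃ N : ℕ, ∀ (F : Type*) [Field F] [Finite F],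
      Odd (Nat.card F) → N ≤ Nat.card F →
        |(powerClassCount 4 F : ℝ) / (Nat.card (ConjClasses (SL2 F)) : ℝ) - 3 / 8| < ε) := by
  refine ⟨?_, ?_, ?_⟩
  · rintro F _ _ q rfl hq
    refine ⟨powerCount_four_rat hq, ?_⟩
    have h := eight_mul_powerClassCount_four hq
    refine ⟨fun h8 => ?_, fun h8 => ?_, fun h8 => ?_, fun h8 => ?_⟩ <;>
      rw [eq_div_iff (by norm_num), mul_comm]
    · exact_mod_cast h.1 h8
    · exact_mod_cast h.2.1 h8
    · exact_mod_cast h.2.2.1 h8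
    · exact_mod_cast h.2.2.2 h8
  · exact fun ε hε => ⟨_, fun F _ _ hq hN => abs_powerCount_four_div_sub_lt hq hε hN⟩
  · exact fun ε hε => ⟨_, fun F _ _ hq hN => abs_powerClassCount_four_div_sub_lt hq hε hN⟩
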